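/- Let $(\mathcal B,\mathbb E,\mathfrak s)$ be an extriangulated category (in the sense of Nakaoka–Palu): $\mathcal B$ is an additive category, $\mathbb E\colon\mathcal B^{\mathrm{op}}\times\mathcal B\to\mathrm{Ab}$ is an additive bifunctor, and $\mathfrak s$ is an additive realization of $\mathbb E$, such that (ET3), (ET3)$^{\mathrm{op}}$, (ET4), (ET4)$^{\mathrm{op}}$ hold. A sequence $A\to B\to C$ is called a conflation, written $A\rightarrowtail B\twoheadrightarrow C$, if it realizes some $\delta\in\mathbb E(C,A)$. (No existence of enough projectives or enough injectives is assumed.) Let $(\mathcal U,\mathcal V)$ be a (complete) cotorsion pair on $\mathcal B$, that is, a pair of full additive subcategories of $\mathcal B$, closed under isomorphisms and direct summands, such that * $\mathbb E(U,V)=0$ for all $U\in\mathcal U$ and $V\in\mathcal V$; * for every object $B\in\mathcal B$ there are conflations $V_B\rightarrowtail U_B\twoheadrightarrow B$ and $B\rightarrowtail V^B\twoheadrightarrow U^B$ with $U_B,U^B\in\mathcal U$ and $V_B,V^B\in\mathcal V$. Put $\mathcal W=\mathcal U\cap\mathcal V$. Let $\mathcal B^+$ be the full subcategory of those $B\in\mathcal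 B$ that admit a conflation $V\rightarrowtail W\twoheadrightarrow B$ with $V\in\mathcal V$, $W\in\mathcal W$, let $\mathcal B^-$ be the full subcategory of those $B\in\mathcal B$ that admit a conflation $B\rightarrowtail W\twoheadrightarrow U$ with $W\in\mathcal W$, $U\in\mathcal U$, and put $\mathcal H=\mathcal B^+\cap\mathcal B^-$. Let $\mathcal B/\mathcal W$ be the additive quotient of $\mathcal B$ by the ideal of morphisms factoring through an object of $\mathcal W$, and let the heart $\underline{\mathcal H}=\mathcal H/\mathcal W$ be the full subcategory of $\mathcal B/\mathcal W$ on the objects of $\mathcal H$. Then $\underline{\mathcal H}$, with the additive structure induced from $\mathcal B$, is an abelian category. -/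

import Mathlib

universe w v u

namespace Extri

open CategoryTheory CategoryTheory.Limits Opposite

/-! ### Extensions attached to a bifunctor `𝔼 : 𝓑ᵒᵖ ⥤ 𝓑 ⥤ Ab` -/

section Extensions

variable {𝓑 : Type u} [Category.{v} 𝓑] (𝔼 : 𝓑ᵒᵖ ⥤ 𝓑 ⥤ AddCommGrpCat.{w})

/-- The abelian group `𝔼(C, A)`, whose elements are the `𝔼`-extensions. -/
abbrev Extn (C A : 𝓑) : Type w := (𝔼.obj (op C)).obj A

variable {𝔼}

/-- `a_* δ = 𝔼(C, a)(δ)`. -/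
def push {C A A' : 𝓑} (a : A ⟶ A') (δ : Extn 𝔼 C A) : Extn 𝔼 C A' :=
  ((𝔼.obj (op C)).map a).hom δ

/-- `c^* δ = 𝔼(c, A)(δ)`. -/
def pull {C C' A : 𝓑} (c : C' ⟶ C) (δ : Extn 𝔼 C A) : Extn 𝔼 C' A :=
  ((𝔼.map c.op).app A).hom δ

/-- The direct sum `δ ⊕ δ'` of two extensions: the extension whose components under
`𝔼(C ⊞ C', A ⊞ A') ≅ 𝔼(C, A) ⊕ 𝔼(C, A') ⊕ 𝔼(C', A) ⊕ 𝔼(C', A')` are `(δ, 0, 0, δ')`. -/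
noncomputable def extSum [Preadditive 𝓑] [HasBinaryBiproducts 𝓑] {C C' A A' : 𝓑}
    (δ : Extn 𝔼 C A) (δ' : Extn 𝔼 C' A') : Extn 𝔼 (C ⊞ C') (A ⊞ A') :=
  pull biprod.fst (push biprod.inl δ) + pull biprod.snd (push biprod.inr δ')

end Extensions

/-! ### Sequences `A ⟶ B ⟶ C` up to equivalence -/

section Sequences

variable {𝓑 : Type u} [Category.{v} 𝓑]

/-- A sequence of morphisms `A ⟶ mid ⟶ C` with fixed ends. -/
structure TwoSeq (A C : 𝓑) where
  /-- the middle term -/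
  mid : 𝓑
  /-- the first morphism -/
  x : A ⟶ mid
  /-- the second morphism -/
  y : mid ⟶ C

/-- Two sequences with the same ends are equivalent if there is an isomorphism of the middle terms
compatible with the morphisms. -/
instance seqSetoid (A C : 𝓑) : Setoid (TwoSeq A C) where
  r S T := ∃ b : S.mid ≅ T.mid, S.x ≫ b.hom = T.x ∧ b.hom ≫ T.y = S.y
  iseqv :=
    { refl := fun S => ⟨Iso.refl _, by simp, by simp⟩
      symm := by
        rintro S T ⟨b, h₁, h₂⟩
        exact ⟨b.symm, by simp [← h₁], by simp [← h₂]⟩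
      trans := by
        rintro S T R ⟨b, h₁, h₂⟩ ⟨b', h₁', h₂'⟩
        exact ⟨b ≪≫ b', by simp [← h₁', ← h₁], by simp [h₂, h₂']⟩ }

/-- Equivalence classes `[A ⟶ B ⟶ C]` of sequences. -/
abbrev SeqClass (A C : 𝓑) := _root_.Quotient (seqSetoid A C)

/-- The equivalence class `[A ⟶ B ⟶ C]` of a sequence. -/
def seqClass {A B C : 𝓑} (x : A ⟶ B) (y : B ⟶ C) : SeqClass A C :=
  _root_.Quotient.mk _ ⟨B, x, y⟩

end Sequences

/-! ### Extriangulated categories -/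

/-- The structure `(𝔼, 𝔰)` of an extriangulated category on an additive category `𝓑`. -/
structure Extriangulation (𝓑 : Type u) [Category.{v} 𝓑] [Preadditive 𝓑]
    [HasZeroObject 𝓑] [HasBinaryBiproducts 𝓑] where
  /-- the bifunctor `𝔼 : 𝓑ᵒᵖ × 𝓑 ⟶ Ab` -/
  𝔼 : 𝓑ᵒᵖ ⥤ 𝓑 ⥤ AddCommGrpCat.{w}
  /-- (ET1) `𝔼` is additive in the second variable -/
  push_add : ∀ {C A A' : 𝓑} (a a' : A ⟶ A') (δ : Extn 𝔼 C A),
    push (a + a') δ = push a δ + push a' δ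
  /-- (ET1) `𝔼` is additive in the first variable -/
  pull_add : ∀ {C C' A : 𝓑} (c c' : C' ⟶ C) (δ : Extn 𝔼 C A),
    pull (c + c') δ = pull c δ + pull c' δ
  /-- the correspondence `𝔰` sending an extension to an equivalence class of sequences -/
  𝔰 : ∀ {C A : 𝓑}, Extn 𝔼 C A → SeqClass A C
  /-- (ET2) `𝔰` is a realization -/
  realize_map : ∀ {A B C A' B' C' : 𝓑} {δ : Extn 𝔼 C A} {δ' : Extn 𝔼 C' A'}
    {x : A ⟶ B} {y : B ⟶ C} {x' : A' ⟶ B'} {y' : B' ⟶ C'},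
    𝔰 δ = seqClass x y → 𝔰 δ' = seqClass x' y' →
    ∀ (a : A ⟶ A') (c : C ⟶ C'), push a δ = pull c δ' →
      ∃ b : B ⟶ B', x ≫ b = a ≫ x' ∧ y ≫ c = b ≫ y'
  /-- (ET2) the split extension is realized by the split sequence -/
  realize_zero : ∀ A C : 𝓑,
    𝔰 (0 : Extn 𝔼 C A) = seqClass (biprod.inl : A ⟶ A ⊞ C) (biprod.snd : A ⊞ C ⟶ C)
  /-- (ET2) direct sums of extensions are realized by direct sums of sequences -/
  realize_sum : ∀ {A B C A' B' C' : 𝓑} {δ : Extn 𝔼 C A} {δ' : Extn 𝔼 C' A'}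
    {x : A ⟶ B} {y : B ⟶ C} {x' : A' ⟶ B'} {y' : B' ⟶ C'},
    𝔰 δ = seqClass x y → 𝔰 δ' = seqClass x' y' →
      𝔰 (extSum δ δ') = seqClass (biprod.map x x') (biprod.map y y')
  /-- (ET3) -/
  ET3 : ∀ {A B C A' B' C' : 𝓑} {δ : Extn 𝔼 C A} {δ' : Extn 𝔼 C' A'}
    {x : A ⟶ B} {y : B ⟶ C} {x' : A' ⟶ B'} {y' : B' ⟶ C'},
    𝔰 δ = seqClass x y → 𝔰 δ' = seqClass x' y' →
    ∀ (a : A ⟶ A') (b : B ⟶ B'), x ≫ b = a ≫ x' →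
      ∃ c : C ⟶ C', push a δ = pull c δ' ∧ y ≫ c = b ≫ y'
  /-- (ET3)ᵒᵖ -/
  ET3op : ∀ {A B C A' B' C' : 𝓑} {δ : Extn 𝔼 C A} {δ' : Extn 𝔼 C' A'}
    {x : A ⟶ B} {y : B ⟶ C} {x' : A' ⟶ B'} {y' : B' ⟶ C'},
    𝔰 δ = seqClass x y → 𝔰 δ' = seqClass x' y' →
    ∀ (b : B ⟶ B') (c : C ⟶ C'), y ≫ c = b ≫ y' →
      ∃ a : A ⟶ A', push a δ = pull c δ' ∧ x ≫ b = a ≫ x'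
  /-- (ET4) -/
  ET4 : ∀ {A B C D F : 𝓑} {δ : Extn 𝔼 D A} {δ' : Extn 𝔼 F B}
    {f : A ⟶ B} {f' : B ⟶ D} {g : B ⟶ C} {g' : C ⟶ F},
    𝔰 δ = seqClass f f' → 𝔰 δ' = seqClass g g' →
      ∃ (E : 𝓑) (h : A ⟶ C) (h' : C ⟶ E) (d : D ⟶ E) (e : E ⟶ F) (δ'' : Extn 𝔼 E A),
        h = f ≫ g ∧ f' ≫ d = g ≫ h' ∧ h' ≫ e = g' ∧
        𝔰 δ'' = seqClass h h' ∧
        𝔰 (push f' δ') = seqClass d e ∧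
        pull d δ'' = δ ∧
        push f δ'' = pull e δ'
  /-- (ET4)ᵒᵖ -/
  ET4op : ∀ {A B C D F : 𝓑} {δ : Extn 𝔼 B D} {δ' : Extn 𝔼 C F}
    {f' : D ⟶ A} {f : A ⟶ B} {g' : F ⟶ B} {g : B ⟶ C},
    𝔰 δ = seqClass f' f → 𝔰 δ' = seqClass g' g →
      ∃ (E : 𝓑) (h' : E ⟶ A) (h : A ⟶ C) (d : D ⟶ E) (e : E ⟶ F) (δ'' : Extn 𝔼 C E),
        h = f ≫ g ∧ h' ≫ f = e ≫ g' ∧ d ≫ h' = f' ∧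
        𝔰 δ'' = seqClass h' h ∧
        𝔰 (pull g' δ) = seqClass d e ∧
        push e δ'' = δ' ∧
        pull g δ'' = push d δ

section Heart

variable {𝓑 : Type u} [Category.{v} 𝓑] [Preadditive 𝓑] [HasZeroObject 𝓑] [HasBinaryBiproducts 𝓑]

/-- `A ⟶ B ⟶ C` is a conflation if it realizes some extension. -/
def Extriangulation.IsConflation (T : Extriangulation.{w} 𝓑) {A B C : 𝓑}
    (x : A ⟶ B) (y : B ⟶ C) : Prop :=
  ∃ δ : Extn T.𝔼 C A, T.𝔰 δ = seqClass x y

/-- Full additive subcategories closed under isomorphisms and direct summands. -/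
structure IsAdditiveSubcategory (P : ObjectProperty 𝓑) : Prop where
  zero : ∀ X : 𝓑, IsZero X → P X
  biprod : ∀ X Y : 𝓑, P X → P Y → P (X ⊞ Y)
  iso : ∀ X Y : 𝓑, (X ≅ Y) → P X → P Y
  summand : ∀ X Y : 𝓑, P (X ⊞ Y) → P X

/-- (Complete) cotorsion pairs on an extriangulated category. -/
structure CotorsionPair (T : Extriangulation.{w} 𝓑) where
  /-- the left-hand class -/
  U : ObjectProperty 𝓑
  /-- the right-hand class -/
  V : ObjectProperty 𝓑
  additive_U : IsAdditiveSubcategory U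
  additive_V : IsAdditiveSubcategory V
  /-- `𝔼(U, V) = 0` -/
  ext_eq_zero : ∀ X Y : 𝓑, U X → V Y → ∀ δ : Extn T.𝔼 X Y, δ = 0
  /-- every `B` admits a conflation `V_B ⟶ U_B ⟶ B` -/
  left_complete : ∀ B : 𝓑, ∃ (Y X : 𝓑) (i : Y ⟶ X) (p : X ⟶ B),
    V Y ∧ U X ∧ T.IsConflation i p
  /-- every `B` admits a conflation `B ⟶ V^B ⟶ U^B` -/
  right_complete : ∀ B : 𝓑, ∃ (Y X : 𝓑) (i : B ⟶ Y) (p : Y ⟶ X),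
    V Y ∧ U X ∧ T.IsConflation i p

namespace CotorsionPair

variable {T : Extriangulation.{w} 𝓑} (P : CotorsionPair T)

/-- The core `𝓦 = 𝓤 ∩ 𝓥`. -/
def W : ObjectProperty 𝓑 := fun X => P.U X ∧ P.V X

/-- `𝓑⁺ = Cone(𝓥, 𝓦)`: the objects `B` with a conflation `V_B ⟶ W_B ⟶ B`. -/
def Bplus : ObjectProperty 𝓑 := fun B =>
  ∃ (Y Z : 𝓑) (i : Y ⟶ Z) (p : Z ⟶ B), P.V Y ∧ P.W Z ∧ T.IsConflation i p

/-- `𝓑⁻ = CoCone(𝓦, 𝓤)`: the objects `B` with a conflation `B ⟶ W^B ⟶ U^B`. -/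
def Bminus : ObjectProperty 𝓑 := fun B =>
  ∃ (Z X : 𝓑) (i : B ⟶ Z) (p : Z ⟶ X), P.W Z ∧ P.U X ∧ T.IsConflation i p

/-- `𝓗 = 𝓑⁺ ∩ 𝓑⁻`. -/
def H : ObjectProperty 𝓑 := fun B => P.Bplus B ∧ P.Bminus B

/-- Two parallel morphisms are identified modulo `𝓦` if their difference factors through an
object of `𝓦`. -/
def rel : HomRel 𝓑 := fun X Y f g =>
  ∃ (Z : 𝓑) (a : X ⟶ Z) (b : Z ⟶ Y), P.W Z ∧ f - g = a ≫ b

lemma rel_add {X Y : 𝓑} {f₁ f₂ g₁ g₂ : X ⟶ Y} (hf : P.rel f₁ f₂) (hg : P.rel g₁ g₂) :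
    P.rel (f₁ + g₁) (f₂ + g₂) := by
  obtain ⟨Z, a, b, hZ, h⟩ := hf
  obtain ⟨Z', a', b', hZ', h'⟩ := hg
  refine ⟨Z ⊞ Z', biprod.lift a a', biprod.desc b b',
    ⟨P.additive_U.biprod _ _ hZ.1 hZ'.1, P.additive_V.biprod _ _ hZ.2 hZ'.2⟩, ?_⟩
  rw [biprod.lift_desc, ← h, ← h']
  abel

open scoped ZeroObject in
lemma rel_refl {X Y : 𝓑} (f : X ⟶ Y) : P.rel f f := by
  exact ⟨0, 0, 0, ⟨P.additive_U.zero _ (isZero_zero 𝓑), P.additive_V.zero _ (isZero_zero 𝓑)⟩,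
    by simp⟩

instance rel_congruence : Congruence P.rel where
  equivalence :=
    { refl := fun f => P.rel_refl f
      symm := by
        rintro f g ⟨Z, a, b, hZ, h⟩
        exact ⟨Z, a, -b, hZ, by rw [Preadditive.comp_neg, ← h, neg_sub]⟩
      trans := by
        intro f g k h₁ h₂
        obtain ⟨Z, a, b, hZ, h⟩ := P.rel_add h₁ h₂
        exact ⟨Z, a, b, hZ, by rw [← h]; abel⟩ }
  comp_left := by
    rintro X Y Z f g g' ⟨Z', a, b, hZ, h⟩
    exact ⟨Z', f ≫ a, b, hZ, by rw [← Preadditive.comp_sub, h, Category.assoc]⟩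
  comp_right := by
    rintro X Y Z f f' g ⟨Z', a, b, hZ, h⟩
    exact ⟨Z', a, b ≫ g, hZ, by rw [← Preadditive.sub_comp, h, Category.assoc]⟩

/-- The quotient category `𝓑/𝓦`. -/
abbrev QuotCat := CategoryTheory.Quotient P.rel

/-- The additive structure of `𝓑/𝓦`, induced by that of `𝓑`. -/
instance : Preadditive P.QuotCat :=
  CategoryTheory.Quotient.preadditive P.rel (fun _ _ _ _ _ _ h h' => P.rel_add h h')

/-- The heart `𝓗/𝓦`: the full subcategory of `𝓑/𝓦` on the objects of `𝓗`. -/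
abbrev Heart := ObjectProperty.FullSubcategory (C := P.QuotCat) (fun X => P.H X.as)

end CotorsionPair

end Heart

end Extri

/-!
Modulo null morphisms (those factoring through `𝓦 = 𝓤 ∩ 𝓥`), every morphism from an object of `𝓤`
to an object of `𝓥` vanishes, and `𝓑⁺` and `𝓑⁻` become the right orthogonal of `𝓤` and the left
orthogonal of `𝓥`: this is what `CotData.Plus` and `CotData.Minus` express. If `B ⟶ Z ⟶ Q` is a
conflation with `Q ∈ 𝓤`, then `B ⟶ Z` is epimorphic with respect to `𝓑⁺`, and `Z ∈ 𝓑⁻` as soon as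
`B ∈ 𝓑⁻` (`CotData.null_of_comp`). Each object has a reflection into `𝓑⁺` of this kind
(`CotData.exists_reflection`).

The cokernel of `f : A ⟶ B` in the heart is found by choosing a conflation `A ⟶ W ⟶ Q` with `W ∈ 𝓦`
and `Q ∈ 𝓤`, pushing it out along `f` to a conflation `B ⟶ M ⟶ Q`, and reflecting `M` into `𝓑⁺`.

Suppose that `f` is a monomorphism of the heart. Then `𝔼(Q, A) ⟶ 𝔼(Q, B)` is injective for all
`Q ∈ 𝓤` (`CotData.eq_zero_of_push_eq_zero`): the pullback `K` of `f` along a conflation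
`V ⟶ W ⟶ B` has null composite to `B`, so its coreflection in the heart has null composite to `A`,
and hence `K ⟶ A` factors through `𝓥`; an extension of `Q` by `A` killed by `f` comes from an
extension of `Q` by `K`, so it vanishes. Now a morphism `h : X ⟶ B` killed by the cokernel of `f`
becomes, in `M`, a morphism through some `S ∈ 𝓤`; by the injectivity just proved, `S ⟶ M ⟶ Q` lifts
to `W`. After subtracting a morphism through `S ⟶ B`, which is null because `B ∈ 𝓑⁺`, and one
through `f`, the morphism `h` is killed by `B ⟶ M`, and the conflation `A ⟶ B ⊞ W ⟶ M` hidden in the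
pushout (`ExtData.exists_factor_of_push`) shows that what remains factors through `f`. So `f` is a
kernel of its cokernel.

Kernels and the normality of epimorphisms follow by duality. For this the argument is carried out
for the structures `ExtData` and `CotData`, which pass to the opposite category without any
comparison of biproducts or of equivalence classes of sequences.
-/

namespace Extri

open CategoryTheory CategoryTheory.Limits Opposite

/-! ### Extriangulated structures in self-dual form -/

section Abstract

/-- A sequence `A ⟶ B ⟶ C` exhibiting `B` as a direct sum of `A` and `C`. -/
def IsSplit {C : Type u} [Category.{v} C] [Preadditive C] {X Y Z : C}
    (x : X ⟶ Y) (y : Y ⟶ Z) : Prop :=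
  ∃ (r : Y ⟶ X) (s : Z ⟶ Y), x ≫ r = 𝟙 X ∧ s ≫ y = 𝟙 Z ∧ s ≫ r = 0 ∧ x ≫ y = 0 ∧
    r ≫ x + y ≫ s = 𝟙 Y

/-- A presentation of extriangulated structures which is visibly invariant under passing to the
opposite category: `real δ x y` says that the sequence `(x, y)` realizes `δ`, and the additivity of
the realization is only recorded through the fact that exactly the split sequences
realize `0`. -/
structure ExtData (C : Type u) [Category.{v} C] [Preadditive C] where
  /-- the groups of extensions, the quotient object coming first -/
  E : C → C → Type w
  /-- the group structure on extensions -/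
  grp : ∀ X Y, AddCommGroup (E X Y)
  /-- covariant functoriality -/
  push : ∀ {X A A' : C}, (A ⟶ A') → E X A →+ E X A'
  /-- contravariant functoriality -/
  pull : ∀ {X X' A : C}, (X' ⟶ X) → E X A →+ E X' A
  /-- the sequence `(x, y)` realizes `δ` -/
  real : ∀ {X Y Z : C}, E Z X → (X ⟶ Y) → (Y ⟶ Z) → Prop
  push_id : ∀ {X A : C} (δ : E X A), push (𝟙 A) δ = δ
  pull_id : ∀ {X A : C} (δ : E X A), pull (𝟙 X) δ = δ
  push_push : ∀ {X A B D : C} (a : A ⟶ B) (b : B ⟶ D) (δ : E X A),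
    push b (push a δ) = push (a ≫ b) δ
  pull_pull : ∀ {A X Y Z : C} (a : X ⟶ Y) (b : Y ⟶ Z) (δ : E Z A),
    pull a (pull b δ) = pull (a ≫ b) δ
  push_pull : ∀ {A B X Y : C} (a : A ⟶ B) (c : X ⟶ Y) (δ : E Y A),
    push a (pull c δ) = pull c (push a δ)
  push_add : ∀ {X A A' : C} (a a' : A ⟶ A') (δ : E X A),
    push (a + a') δ = push a δ + push a' δ
  pull_add : ∀ {X X' A : C} (a a' : X' ⟶ X) (δ : E X A),
    pull (a + a') δ = pull a δ + pull a' δ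
  exists_real : ∀ {Z X : C} (δ : E Z X), ∃ (Y : C) (x : X ⟶ Y) (y : Y ⟶ Z), real δ x y
  real_zero : ∀ {X Y Z : C} (x : X ⟶ Y) (y : Y ⟶ Z), real 0 x y ↔ IsSplit x y
  real_map : ∀ {X Y Z X' Y' Z' : C} {δ : E Z X} {δ' : E Z' X'}
    {x : X ⟶ Y} {y : Y ⟶ Z} {x' : X' ⟶ Y'} {y' : Y' ⟶ Z'},
    real δ x y → real δ' x' y' →
    ∀ (a : X ⟶ X') (c : Z ⟶ Z'), push a δ = pull c δ' →
      ∃ b : Y ⟶ Y', x ≫ b = a ≫ x' ∧ y ≫ c = b ≫ y'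
  ET3 : ∀ {X Y Z X' Y' Z' : C} {δ : E Z X} {δ' : E Z' X'}
    {x : X ⟶ Y} {y : Y ⟶ Z} {x' : X' ⟶ Y'} {y' : Y' ⟶ Z'},
    real δ x y → real δ' x' y' →
    ∀ (a : X ⟶ X') (b : Y ⟶ Y'), x ≫ b = a ≫ x' →
      ∃ c : Z ⟶ Z', push a δ = pull c δ' ∧ y ≫ c = b ≫ y'
  ET3op : ∀ {X Y Z X' Y' Z' : C} {δ : E Z X} {δ' : E Z' X'}
    {x : X ⟶ Y} {y : Y ⟶ Z} {x' : X' ⟶ Y'} {y' : Y' ⟶ Z'},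
    real δ x y → real δ' x' y' →
    ∀ (b : Y ⟶ Y') (c : Z ⟶ Z'), y ≫ c = b ≫ y' →
      ∃ a : X ⟶ X', push a δ = pull c δ' ∧ x ≫ b = a ≫ x'
  ET4 : ∀ {A B X D F : C} {δ : E D A} {δ' : E F B}
    {f : A ⟶ B} {f' : B ⟶ D} {g : B ⟶ X} {g' : X ⟶ F},
    real δ f f' → real δ' g g' →
      ∃ (Z : C) (h' : X ⟶ Z) (d : D ⟶ Z) (e : Z ⟶ F) (δ'' : E Z A),
        f' ≫ d = g ≫ h' ∧ h' ≫ e = g' ∧ real δ'' (f ≫ g) h' ∧ real (push f' δ') d e ∧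
        pull d δ'' = δ ∧ push f δ'' = pull e δ'
  ET4op : ∀ {A B X D F : C} {δ : E B D} {δ' : E X F}
    {f' : D ⟶ A} {f : A ⟶ B} {g' : F ⟶ B} {g : B ⟶ X},
    real δ f' f → real δ' g' g →
      ∃ (Z : C) (h' : Z ⟶ A) (d : D ⟶ Z) (e : Z ⟶ F) (δ'' : E X Z),
        h' ≫ f = e ≫ g' ∧ d ≫ h' = f' ∧ real δ'' h' (f ≫ g) ∧ real (pull g' δ) d e ∧
        push e δ'' = δ' ∧ pull g δ'' = push d δ

attribute [instance] ExtData.grp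

variable {C : Type u} [Category.{v} C] [Preadditive C]

namespace ExtData

/-- The opposite structure, in which the two variables of the extension groups, and the two
morphisms of a sequence, are exchanged. -/
def op (D : ExtData.{w} C) : ExtData.{w} Cᵒᵖ where
  E X Y := D.E Y.unop X.unop
  grp X Y := D.grp Y.unop X.unop
  push a := D.pull a.unop
  pull a := D.push a.unop
  real δ x y := D.real δ y.unop x.unop
  push_id δ := D.pull_id δ
  pull_id δ := D.push_id δ
  push_push a b δ := D.pull_pull b.unop a.unop δ
  pull_pull a b δ := D.push_push b.unop a.unop δ
  push_pull a c δ := (D.push_pull c.unop a.unop δ).symm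
  push_add a a' δ := D.pull_add a.unop a'.unop δ
  pull_add a a' δ := D.push_add a.unop a'.unop δ
  exists_real δ := by
    obtain ⟨Y, x, y, h⟩ := D.exists_real δ
    exact ⟨.op Y, y.op, x.op, h⟩
  real_zero x y := by
    refine (D.real_zero y.unop x.unop).trans ⟨?_, ?_⟩
    · rintro ⟨r, s, h₁, h₂, h₃, h₄, h₅⟩
      refine ⟨s.op, r.op, Quiver.Hom.unop_inj h₂, Quiver.Hom.unop_inj h₁, Quiver.Hom.unop_inj h₃,
        Quiver.Hom.unop_inj h₄, Quiver.Hom.unop_inj ((add_comm _ _).trans h₅)⟩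
    · rintro ⟨r, s, h₁, h₂, h₃, h₄, h₅⟩
      refine ⟨s.unop, r.unop, Quiver.Hom.op_inj h₂, Quiver.Hom.op_inj h₁, Quiver.Hom.op_inj h₃,
        Quiver.Hom.op_inj h₄, Quiver.Hom.op_inj ((add_comm _ _).trans h₅)⟩
  real_map h h' a c e := by
    obtain ⟨b, h₁, h₂⟩ := D.real_map h' h c.unop a.unop e.symm
    exact ⟨b.op, Quiver.Hom.unop_inj h₂.symm, Quiver.Hom.unop_inj h₁.symm⟩
  ET3 h h' a b e := by
    obtain ⟨c, h₁, h₂⟩ := D.ET3op h' h b.unop a.unop (Quiver.Hom.op_inj e.symm)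
    exact ⟨c.op, h₁.symm, Quiver.Hom.unop_inj h₂.symm⟩
  ET3op h h' b c e := by
    obtain ⟨a, h₁, h₂⟩ := D.ET3 h' h c.unop b.unop (Quiver.Hom.op_inj e.symm)
    exact ⟨a.op, h₁.symm, Quiver.Hom.unop_inj h₂.symm⟩
  ET4 h h' := by
    obtain ⟨Z, h', d, e, δ, h₁, h₂, h₃, h₄, h₅, h₆⟩ := D.ET4op h' h
    exact ⟨.op Z, h'.op, e.op, d.op, δ, Quiver.Hom.unop_inj h₁.symm, Quiver.Hom.unop_inj h₂,
      h₃, h₄, h₅, h₆⟩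
  ET4op h h' := by
    obtain ⟨Z, h', d, e, δ, h₁, h₂, h₃, h₄, h₅, h₆⟩ := D.ET4 h' h
    exact ⟨.op Z, h'.op, e.op, d.op, δ, Quiver.Hom.unop_inj h₁.symm, Quiver.Hom.unop_inj h₂,
      h₃, h₄, h₅, h₆⟩

variable (D : ExtData.{w} C)

lemma push_zero {X A A' : C} (δ : D.E X A) : D.push (0 : A ⟶ A') δ = 0 := by
  simpa using D.push_add (0 : A ⟶ A') 0 δ

lemma pull_zero {X X' A : C} (δ : D.E X A) : D.pull (0 : X' ⟶ X) δ = 0 :=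
  D.op.push_zero (A := .op X) (A' := .op X') (X := .op A) δ

variable {D} in
/-- Exactness of `𝔼(Z, T) ⟶ 𝔼(Y, T) ⟶ 𝔼(X, T)` at the middle term. -/
lemma exists_eq_pull {X Y Z : C} {δ : D.E Z X} {x : X ⟶ Y} {y : Y ⟶ Z} (h : D.real δ x y)
    {T : C} (ε : D.E Y T) (hε : D.pull x ε = 0) :
    ∃ ε' : D.E Z T, D.pull y ε' = ε := by
  obtain ⟨R, i, p, hR⟩ := D.exists_real ε
  obtain ⟨K, -, d, e, δ', -, -, -, h₄, -, h₆⟩ := D.ET4op hR h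
  rw [hε, D.real_zero] at h₄
  obtain ⟨r, s, h₇, -⟩ := h₄
  exact ⟨D.push r δ', by rw [← D.push_pull, h₆, D.push_push, h₇, D.push_id]⟩

section

variable [HasZeroObject C] {X Y Z : C} {δ : D.E Z X} {x : X ⟶ Y} {y : Y ⟶ Z}

open scoped ZeroObject

lemma real_id_zero (X : C) : D.real (0 : D.E 0 X) (𝟙 X) (0 : X ⟶ 0) :=
  (D.real_zero _ _).2 ⟨𝟙 X, 0, by simp, by simp, by simp, by simp, by simp⟩

lemma real_zero_id (X : C) : D.real (0 : D.E X 0) (0 : 0 ⟶ X) (𝟙 X) :=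
  (D.real_zero _ _).2 ⟨0, 𝟙 X, by simp, by simp, by simp, by simp, by simp⟩

variable {D}

lemma comp_eq_zero (h : D.real δ x y) : x ≫ y = 0 := by
  obtain ⟨b, h₁, h₂⟩ := D.real_map (D.real_id_zero X) h (𝟙 X) 0 (by simp [pull_zero])
  simp only [Category.id_comp] at h₁
  rw [← h₁, ← h₂]; simp

lemma push_eq_zero (h : D.real δ x y) : D.push x δ = 0 := by
  obtain ⟨c, h₁, -⟩ := D.ET3 h (D.real_id_zero Y) x (𝟙 Y) (by simp)
  simpa using h₁

lemma pull_eq_zero (h : D.real δ x y) : D.pull y δ = 0 := by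
  obtain ⟨c, h₁, -⟩ := D.ET3op (D.real_zero_id Y) h (𝟙 Y) y (by simp)
  simpa using h₁.symm

/-- Exactness of `Hom(Y, T) ⟶ Hom(X, T) ⟶ 𝔼(Z, T)` at the middle term. -/
lemma exists_extend (h : D.real δ x y) {T : C} (g : X ⟶ T) (hg : D.push g δ = 0) :
    ∃ k : Y ⟶ T, x ≫ k = g := by
  obtain ⟨b, h₁, -⟩ := D.real_map h (D.real_id_zero T) g 0 (by simp [hg])
  exact ⟨b, by simpa using h₁⟩

/-- Exactness of `Hom(T, Y) ⟶ Hom(T, Z) ⟶ 𝔼(T, X)` at the middle term. -/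
lemma exists_lift (h : D.real δ x y) {T : C} (g : T ⟶ Z) (hg : D.pull g δ = 0) :
    ∃ k : T ⟶ Y, k ≫ y = g := by
  obtain ⟨b, -, h₁⟩ := D.real_map (D.real_zero_id T) h 0 g (by simp [hg])
  exact ⟨b, by simpa using h₁.symm⟩

/-- Exactness of `Hom(Z, T) ⟶ Hom(Y, T) ⟶ Hom(X, T)` at the middle term. -/
lemma exists_desc (h : D.real δ x y) {T : C} (g : Y ⟶ T) (hg : x ≫ g = 0) :
    ∃ k : Z ⟶ T, y ≫ k = g := by
  obtain ⟨c, -, h₁⟩ := D.ET3 h (D.real_zero_id T) 0 g (by simp [hg])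
  exact ⟨c, by simpa using h₁⟩

/-- Exactness of `Hom(T, X) ⟶ Hom(T, Y) ⟶ Hom(T, Z)` at the middle term. -/
lemma exists_factor (h : D.real δ x y) {T : C} (g : T ⟶ Y) (hg : g ≫ y = 0) :
    ∃ k : T ⟶ X, k ≫ x = g := by
  obtain ⟨c, -, h₁⟩ := D.ET3op (D.real_id_zero T) h g 0 (by simp [hg])
  exact ⟨c, by simpa using h₁.symm⟩

/-- A morphism killed by the first map of a pushed-out conflation factors through the
morphism along which the conflation is pushed out. -/
lemma exists_factor_of_push (h : D.real δ x y) {T N : C} (f : X ⟶ T) {c : T ⟶ N} {m : N ⟶ Z}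
    (hc : D.real (D.push f δ) c m) {S : C} (g : S ⟶ T) (hg : g ≫ c = 0) :
    ∃ k : S ⟶ X, k ≫ f = g := by
  -- `B` is a direct sum of `T` and `Y`
  obtain ⟨B, l, p, hB⟩ := D.exists_real (0 : D.E Y T)
  obtain ⟨ρ, -, hlρ, -⟩ := (D.real_zero _ _).1 hB
  -- `K` is a direct sum of `T` and `X`
  obtain ⟨K, h', d, e, δ', -, h₂, h₃, h₄, h₅, -⟩ := D.ET4op hB h
  rw [map_zero] at h₄
  obtain ⟨-, s₀, -, hs₀, -, hde, -⟩ := (D.real_zero _ _).1 h₄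
  -- the retraction of `d` is chosen as a component of `h'`, and the section of `e` accordingly
  set r := h' ≫ ρ with hr
  have hdr : d ≫ r = 𝟙 T := by rw [hr, reassoc_of% h₂, hlρ]
  obtain ⟨s, hse, hsr⟩ : ∃ s : X ⟶ K, s ≫ e = 𝟙 X ∧ s ≫ r = 0 :=
    ⟨s₀ - s₀ ≫ r ≫ d, by simp [hs₀, hde], by simp [hdr]⟩
  have hB₂ : r ≫ d + e ≫ s = 𝟙 K := by
    obtain ⟨k, hk⟩ := exists_desc h₄ (𝟙 K - r ≫ d - e ≫ s)
      (by simp [reassoc_of% hdr, reassoc_of% hde])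
    have hk₀ : k = 0 := by
      rw [← Category.id_comp k, ← hse, Category.assoc, hk]
      simp [reassoc_of% hsr, reassoc_of% hse]
    rw [hk₀, comp_zero, sub_sub] at hk
    exact (sub_eq_zero.1 hk.symm).symm
  -- the split conflation attached to the graph of `-f`
  have hsplit : D.real (0 : D.E T X) (s - f ≫ d) (r + e ≫ f) := by
    refine (D.real_zero _ _).2 ⟨e, d, ?_, ?_, hde, ?_, ?_⟩
    · simp [hse, hde]
    · simp [hdr, reassoc_of% hde]
    · simp [hsr, reassoc_of% hse, hdr, reassoc_of% hde]
    · simp only [← hB₂, Preadditive.comp_sub, Preadditive.add_comp, Category.assoc]; abel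
  obtain ⟨M, h'', d', e', δ₃, h₇, -, h₉, h₁₀, -⟩ := D.ET4 hsplit h₃
  have hpush : D.push (r + e ≫ f) δ' = D.push f δ := by
    rw [D.push_add, ← D.push_push e f, h₅, hr, ← D.push_push h' ρ, push_eq_zero h₃, map_zero,
      zero_add]
  rw [hpush] at h₁₀
  obtain ⟨b, hb, -⟩ := D.real_map hc h₁₀ (𝟙 T) (𝟙 Z) (by rw [D.push_id, D.pull_id])
  have hgd : g ≫ d' = 0 := by
    rw [← Category.id_comp d', ← hb, reassoc_of% hg, zero_comp]
  obtain ⟨k, hk⟩ := exists_factor h₉ (g ≫ l) (by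
    rw [← h₂, Category.assoc, Category.assoc, ← h₇, Preadditive.add_comp]
    simp [reassoc_of% hdr, reassoc_of% hde, hgd])
  refine ⟨-k, ?_⟩
  have := congr($hk ≫ ρ)
  simp only [Category.assoc, ← hr, Preadditive.sub_comp, hsr, hdr, hlρ] at this
  simpa using this

end

end ExtData

/-! ### Cotorsion pairs in self-dual form -/

/-- Complete cotorsion pairs, in the form in which each class is the orthogonal of the other. -/
structure CotData (D : ExtData.{w} C) where
  /-- the left-hand class -/
  U : C → Prop
  /-- the right-hand class -/
  V : C → Prop
  U_iff : ∀ X, U X ↔ ∀ Y, V Y → ∀ δ : D.E X Y, δ = 0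
  V_iff : ∀ Y, V Y ↔ ∀ X, U X → ∀ δ : D.E X Y, δ = 0
  left : ∀ B, ∃ (Y X : C) (δ : D.E B Y) (i : Y ⟶ X) (p : X ⟶ B), V Y ∧ U X ∧ D.real δ i p
  right : ∀ B, ∃ (Y X : C) (δ : D.E X B) (i : B ⟶ Y) (p : Y ⟶ X), V Y ∧ U X ∧ D.real δ i p

namespace CotData

variable {D : ExtData.{w} C}

/-- The opposite of a cotorsion pair exchanges its two classes. -/
def op (P : CotData D) : CotData D.op where
  U X := P.V X.unop
  V X := P.U X.unop
  U_iff X := (P.V_iff X.unop).trans ⟨fun h Y => h Y.unop, fun h Y => h (.op Y)⟩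
  V_iff X := (P.U_iff X.unop).trans ⟨fun h Y => h Y.unop, fun h Y => h (.op Y)⟩
  left B := by
    obtain ⟨Y, X, δ, i, p, hY, hX, h⟩ := P.right B.unop
    exact ⟨.op X, .op Y, δ, p.op, i.op, hX, hY, h⟩
  right B := by
    obtain ⟨Y, X, δ, i, p, hY, hX, h⟩ := P.left B.unop
    exact ⟨.op X, .op Y, δ, p.op, i.op, hX, hY, h⟩

variable (P : CotData D)

/-- Morphisms that factor through an object of the core `U ∩ V`. -/
def Null {X Y : C} (f : X ⟶ Y) : Prop :=
  ∃ (Z : C) (a : X ⟶ Z) (b : Z ⟶ Y), P.U Z ∧ P.V Z ∧ a ≫ b = f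

/-- The objects that receive only null morphisms from `U`. -/
def Plus (B : C) : Prop := ∀ X, P.U X → ∀ f : X ⟶ B, P.Null f

/-- The objects that have only null morphisms to `V`. -/
def Minus (B : C) : Prop := ∀ Y, P.V Y → ∀ f : B ⟶ Y, P.Null f

variable {P}

lemma null_op {X Y : Cᵒᵖ} {f : X ⟶ Y} : P.op.Null f ↔ P.Null f.unop := by
  constructor
  · rintro ⟨Z, a, b, h₁, h₂, rfl⟩
    exact ⟨Z.unop, b.unop, a.unop, h₂, h₁, rfl⟩
  · rintro ⟨Z, a, b, h₁, h₂, h₃⟩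
    exact ⟨.op Z, b.op, a.op, h₂, h₁, Quiver.Hom.unop_inj h₃⟩

lemma plus_op {X : Cᵒᵖ} : P.op.Plus X ↔ P.Minus X.unop :=
  ⟨fun h Y hY f => null_op.1 (h (.op Y) hY f.op), fun h Y hY f => null_op.2 (h Y.unop hY f.unop)⟩

lemma minus_op {X : Cᵒᵖ} : P.op.Minus X ↔ P.Plus X.unop :=
  ⟨fun h Y hY f => null_op.1 (h (.op Y) hY f.op), fun h Y hY f => null_op.2 (h Y.unop hY f.unop)⟩

lemma ext_eq_zero {X Y : C} (hX : P.U X) (hY : P.V Y) (δ : D.E X Y) : δ = 0 :=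
  (P.U_iff X).1 hX Y hY δ

lemma U_of_real {X Y Z : C} {δ : D.E Z X} {x : X ⟶ Y} {y : Y ⟶ Z} (h : D.real δ x y)
    (hX : P.U X) (hZ : P.U Z) : P.U Y := by
  refine (P.U_iff Y).2 fun T hT ε => ?_
  obtain ⟨ε', rfl⟩ := ExtData.exists_eq_pull h ε (ext_eq_zero hX hT _)
  rw [ext_eq_zero hZ hT ε', map_zero]

lemma V_of_real {X Y Z : C} {δ : D.E Z X} {x : X ⟶ Y} {y : Y ⟶ Z} (h : D.real δ x y)
    (hX : P.V X) (hZ : P.V Z) : P.V Y :=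
  U_of_real (P := P.op) (D := D.op) (X := .op Z) (Y := .op Y) (Z := .op X) (x := y.op)
    (y := x.op) (δ := δ) h hZ hX

section

lemma Null.comp_left {X Y Z : C} {g : Y ⟶ Z} (hg : P.Null g) (f : X ⟶ Y) : P.Null (f ≫ g) := by
  obtain ⟨T, a, b, h₁, h₂, rfl⟩ := hg
  exact ⟨T, f ≫ a, b, h₁, h₂, by simp⟩

lemma Null.comp_right {X Y Z : C} {f : X ⟶ Y} (hf : P.Null f) (g : Y ⟶ Z) :
    P.Null (f ≫ g) := by
  obtain ⟨T, a, b, h₁, h₂, rfl⟩ := hf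
  exact ⟨T, a, b ≫ g, h₁, h₂, by simp⟩

lemma Null.add {X Y : C} {f g : X ⟶ Y} (hf : P.Null f) (hg : P.Null g) : P.Null (f + g) := by
  obtain ⟨S, a, b, h₁, h₂, rfl⟩ := hf
  obtain ⟨T, c, d, h₃, h₄, rfl⟩ := hg
  -- `S` and `T` have a direct sum in the core
  obtain ⟨N, x, y, h⟩ := D.exists_real (0 : D.E T S)
  obtain ⟨r, s, h₅, h₆, h₇, h₈, -⟩ := (D.real_zero _ _).1 h
  refine ⟨N, a ≫ x + c ≫ s, r ≫ b + y ≫ d, U_of_real h h₁ h₃, V_of_real h h₂ h₄, ?_⟩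
  simp [reassoc_of% h₅, reassoc_of% h₆, reassoc_of% h₇, reassoc_of% h₈]

variable (P) in
/-- Pushing out along a null morphism kills the extensions of an object of `U`. -/
lemma push_null {X A B : C} {f : A ⟶ B} (hf : P.Null f) (hX : P.U X) (δ : D.E X A) :
    D.push f δ = 0 := by
  obtain ⟨T, a, b, h₁, h₂, rfl⟩ := hf
  rw [← D.push_push, ext_eq_zero hX h₂ (D.push a δ), map_zero]

variable [HasZeroObject C]

lemma exists_extend {X Y Z T : C} {δ : D.E Z X} {x : X ⟶ Y} {y : Y ⟶ Z} (h : D.real δ x y)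
    (hZ : P.U Z) (hT : P.V T) (g : X ⟶ T) : ∃ k : Y ⟶ T, x ≫ k = g :=
  ExtData.exists_extend h g (ext_eq_zero hZ hT _)

lemma exists_lift {X Y Z T : C} {δ : D.E Z X} {x : X ⟶ Y} {y : Y ⟶ Z} (h : D.real δ x y)
    (hX : P.V X) (hT : P.U T) (g : T ⟶ Z) : ∃ k : T ⟶ Y, k ≫ y = g :=
  ExtData.exists_lift h g (ext_eq_zero hT hX _)

lemma null_of_U_of_V {X Y : C} (hX : P.U X) (hY : P.V Y) (f : X ⟶ Y) : P.Null f := by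
  obtain ⟨T, S, δ, i, p, hT, hS, h⟩ := P.right X
  obtain ⟨k, hk⟩ := exists_extend h hS hY f
  exact ⟨T, i, k, U_of_real h hX hS, hT, hk⟩

/-! ### The classes `Plus` and `Minus` -/

lemma plus_of_real {X Y Z : C} {δ : D.E Z X} {x : X ⟶ Y} {y : Y ⟶ Z} (h : D.real δ x y)
    (hX : P.V X) (hY : P.V Y) : P.Plus Z := by
  intro T hT f
  obtain ⟨k, rfl⟩ := exists_lift h hX hT f
  exact (null_of_U_of_V hT hY k).comp_right y

lemma Plus.exists_real {B : C} (hB : P.Plus B) :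
    ∃ (Y X : C) (δ : D.E B Y) (i : Y ⟶ X) (p : X ⟶ B), P.V Y ∧ P.U X ∧ P.V X ∧
      D.real δ i p := by
  obtain ⟨Y, X, δ, i, p, hY, hX, h⟩ := P.left B
  refine ⟨Y, X, δ, i, p, hY, hX, (P.V_iff X).2 fun T hT ε => ?_, h⟩
  -- up to a null morphism, the identity of `X` factors through `Y`, which lies in `V`
  obtain ⟨S, a, b, hS, hS', hab⟩ := hB X hX p
  obtain ⟨l, rfl⟩ := exists_lift h hY hS b
  obtain ⟨k, hk⟩ := ExtData.exists_factor h (𝟙 X - a ≫ l) (by simp [hab])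
  rw [← D.push_id ε, ← sub_add_cancel (𝟙 X) (a ≫ l), ← hk, D.push_add, ← D.push_push,
    ← D.push_push, ext_eq_zero hT hY (D.push k ε), ext_eq_zero hT hS' (D.push a ε), map_zero,
    map_zero, add_zero]

lemma minus_of_real {X Y Z : C} {δ : D.E Z X} {x : X ⟶ Y} {y : Y ⟶ Z} (h : D.real δ x y)
    (hZ : P.U Z) (hY : P.U Y) : P.Minus X :=
  plus_op.1 (plus_of_real (P := P.op) (X := .op Z) (Y := .op Y) (Z := .op X) (x := y.op)
    (y := x.op) (δ := δ) h hZ hY)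

lemma Minus.exists_real {B : C} (hB : P.Minus B) :
    ∃ (Y X : C) (δ : D.E X B) (i : B ⟶ Y) (p : Y ⟶ X), P.U X ∧ P.U Y ∧ P.V Y ∧
      D.real δ i p := by
  obtain ⟨X, Y, δ, p, i, hX, hV, hU, h⟩ := Plus.exists_real (plus_op.2 hB : P.op.Plus (.op B))
  exact ⟨Y.unop, X.unop, δ, i.unop, p.unop, hX, hU, hV, h⟩

/-- If `B ⟶ Z ⟶ Q` is a conflation with `Q` in `U`, then `B ⟶ Z` is, modulo null morphisms, an
epimorphism with respect to the objects that receive only null morphisms from `Q`. -/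
lemma null_of_comp {B Z Q T : C} {δ : D.E Q B} {b : B ⟶ Z} {z : Z ⟶ Q} (h : D.real δ b z)
    (hQ : P.U Q) (hT : ∀ g : Q ⟶ T, P.Null g) {k : Z ⟶ T} (hk : P.Null (b ≫ k)) :
    P.Null k := by
  obtain ⟨S, a, c, hU, hV, hac⟩ := hk
  obtain ⟨l, rfl⟩ := exists_extend h hQ hV a
  obtain ⟨q, hq⟩ := ExtData.exists_desc h (k - l ≫ c) (by simp [← hac])
  have : P.Null (l ≫ c) := ⟨S, l, c, hU, hV, rfl⟩
  simpa [hq] using ((hT q).comp_left z).add this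

lemma Minus.of_real {B Z Q : C} (hB : P.Minus B) {δ : D.E Q B} {b : B ⟶ Z} {z : Z ⟶ Q}
    (h : D.real δ b z) (hQ : P.U Q) : P.Minus Z :=
  fun Y hY _ => null_of_comp h hQ (null_of_U_of_V hQ hY) (hB Y hY _)

lemma Plus.of_real {B Z Q : C} (hB : P.Plus B) {δ : D.E B Q} {b : Q ⟶ Z} {z : Z ⟶ B}
    (h : D.real δ b z) (hQ : P.V Q) : P.Plus Z :=
  minus_op.1 (Minus.of_real (P := P.op) (B := .op B) (Z := .op Z) (Q := .op Q) (minus_op.2 hB)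
    (b := z.op) (z := b.op) (δ := δ) h hQ)

/-! ### Reflections, cokernels and kernels -/

variable (P) in
/-- Every object has a reflection into the objects satisfying `Plus`, which is an inflation with
cokernel in `U`; the morphisms it annihilates modulo null morphisms factor through `U`. -/
lemma exists_reflection (B : C) :
    ∃ (Z Q : C) (δ : D.E Q B) (b : B ⟶ Z) (z : Z ⟶ Q), D.real δ b z ∧ P.U Q ∧ P.Plus Z ∧
      (∀ (Y : C) (_ : P.Plus Y) (g : B ⟶ Y), ∃ k : Z ⟶ Y, b ≫ k = g) ∧
      ∀ (X : C) (g : X ⟶ B), P.Null (g ≫ b) →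
        ∃ (S : C) (s : X ⟶ S) (p : S ⟶ B), P.U S ∧ s ≫ p = g := by
  obtain ⟨V₀, U₀, θ, i, p, hV₀, hU₀, h⟩ := P.left B
  obtain ⟨W, Q, φ, a, q, hW, hQ, h'⟩ := P.right U₀
  obtain ⟨Z, w, b, z, δ, h₁, h₂, h₃, h₄, -⟩ := D.ET4 h h'
  have hWU : P.U W := U_of_real h' hU₀ hQ
  refine ⟨Z, Q, D.push p φ, b, z, h₄, hQ, plus_of_real h₃ hV₀ hW, fun Y hY g => ?_,
    fun X g hg => ?_⟩
  · exact ExtData.exists_extend h₄ g (by rw [D.push_push, push_null P (hY U₀ hU₀ _) hQ])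
  · obtain ⟨S, c, d, hS, -, hcd⟩ := hg
    obtain ⟨l, rfl⟩ := exists_lift h₃ hV₀ hS d
    obtain ⟨s₀, hs₀⟩ := ExtData.exists_factor h' (c ≫ l) (by
      rw [← h₂, Category.assoc, reassoc_of% hcd, ExtData.comp_eq_zero h₄, comp_zero])
    obtain ⟨k, hk⟩ := ExtData.exists_factor_of_push h' p h₄ (g - s₀ ≫ p) (by
      rw [Preadditive.sub_comp, ← hcd, Category.assoc, h₁, reassoc_of% hs₀, sub_self])
    exact ⟨U₀, s₀ + k, p, hU₀, by simp [hk]⟩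

/-- Dually, an object `K` satisfying `Plus` has a coreflection `K' ⟶ K` in the heart, and the
morphisms out of `K` whose restriction to `K'` is null factor through `V`. -/
lemma exists_coreflection_factor {K : C} (hK : P.Plus K) :
    ∃ (K' : C) (c : K' ⟶ K), P.Plus K' ∧ P.Minus K' ∧
      ∀ (A : C) (e : K ⟶ A), P.Null (c ≫ e) →
        ∃ (S : C) (s : K ⟶ S) (p : S ⟶ A), P.V S ∧ s ≫ p = e := by
  obtain ⟨Z, Q, δ, b, z, h, hQ, hZ, -, hf⟩ := exists_reflection P.op (.op K)
  refine ⟨Z.unop, b.unop, minus_op.1 (Minus.of_real (P := P.op) (minus_op.2 hK) h hQ), plus_op.1 hZ,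
    fun A e he => ?_⟩
  obtain ⟨S, s, p, hS, hsp⟩ := hf (.op A) e.op (null_op.2 he)
  exact ⟨S.unop, p.unop, s.unop, hS, Quiver.Hom.op_inj hsp⟩

/-- A monomorphism of the heart induces an injection on the extensions of any object of `U`. -/
lemma eq_zero_of_push_eq_zero {A B : C} (hA : P.Plus A) (hB : P.Plus B) {f : A ⟶ B}
    (hf : ∀ X, P.Plus X → P.Minus X → ∀ g : X ⟶ A, P.Null (g ≫ f) → P.Null g)
    {Q : C} (hQ : P.U Q) {ε : D.E Q A} (hε : D.push f ε = 0) : ε = 0 := by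
  obtain ⟨V₀, W, θ, i, p, hV₀, hWU, hWV, h⟩ := hB.exists_real
  obtain ⟨R, x, y, hR⟩ := D.exists_real ε
  obtain ⟨f', hf'⟩ := ExtData.exists_extend hR f hε
  obtain ⟨T, j, q, hT⟩ := D.exists_real (D.pull f' θ)
  obtain ⟨K, -, d, e, δ, -, -, -, h₄, h₅, -⟩ := D.ET4op hT hR
  rw [D.pull_pull, hf'] at h₄
  -- `K` is the pullback of `f` along `p`, a weak kernel of `f` modulo null morphisms
  have hef : P.Null (e ≫ f) := by
    obtain ⟨k, hk⟩ := ExtData.exists_lift h (e ≫ f) (by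
      rw [← D.pull_pull, ExtData.pull_eq_zero h₄])
    exact ⟨W, k, p, hWU, hWV, hk⟩
  obtain ⟨K', c, hK₁, hK₂, hK₃⟩ := exists_coreflection_factor (hA.of_real h₄ hV₀)
  obtain ⟨S, s, t, hS, hst⟩ := hK₃ A e (hf K' hK₁ hK₂ _ (by
    rw [Category.assoc]; exact hef.comp_left c))
  rw [← h₅, ← hst, ← D.push_push, ext_eq_zero hQ hS (D.push s δ), map_zero]

/-- Cokernels of the heart: the pushout of `A ⟶ W` along `f`, where `A ⟶ W` is an inflation into
the core with cokernel in `U`, is reflected into the objects satisfying `Plus`. If `f` is a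
monomorphism of the heart, then it is moreover a kernel of its cokernel. -/
lemma exists_cokernel {A B : C} (hA : P.Plus A) (hA' : P.Minus A) (hB : P.Plus B)
    (hB' : P.Minus B) (f : A ⟶ B) :
    ∃ (Z : C) (g : B ⟶ Z), P.Plus Z ∧ P.Minus Z ∧ P.Null (f ≫ g) ∧
      (∀ (Y : C) (_ : P.Plus Y) (h : B ⟶ Y), P.Null (f ≫ h) → ∃ k : Z ⟶ Y, g ≫ k = h) ∧
      (∀ (Y : C) (_ : P.Plus Y) (k : Z ⟶ Y), P.Null (g ≫ k) → P.Null k) ∧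
      ((∀ X, P.Plus X → P.Minus X → ∀ g : X ⟶ A, P.Null (g ≫ f) → P.Null g) →
        ∀ (X : C) (h : X ⟶ B), P.Null (h ≫ g) → ∃ k : X ⟶ A, P.Null (h - k ≫ f)) := by
  obtain ⟨W, Q, δ, i, j, hQ, hWU, hWV, h⟩ := hA'.exists_real
  obtain ⟨M, c, m, hM⟩ := D.exists_real (D.push f δ)
  obtain ⟨w, hw, hwm⟩ := D.real_map h hM f (𝟙 Q) (by rw [D.pull_id])
  rw [Category.comp_id] at hwm
  have hfc : P.Null (f ≫ c) := ⟨W, i, w, hWU, hWV, hw⟩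
  obtain ⟨Z, Q', δ', b, z, h', hQ', hZ, hZ₁, hZ₂⟩ := exists_reflection P M
  refine ⟨Z, c ≫ b, hZ, (hB'.of_real hM hQ).of_real h' hQ', ?_, fun Y hY g hg => ?_,
    fun Y hY k hk => ?_, fun hf X g hg => ?_⟩
  · rw [← Category.assoc]; exact hfc.comp_right b
  · obtain ⟨k, rfl⟩ := ExtData.exists_extend hM g (by rw [D.push_push, push_null P hg hQ])
    obtain ⟨l, rfl⟩ := hZ₁ Y hY k
    exact ⟨l, by simp⟩
  · rw [Category.assoc] at hk
    exact null_of_comp h' hQ' (hY Q' hQ') (null_of_comp hM hQ (hY Q hQ) hk)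
  · obtain ⟨S, s, p, hS, hsp⟩ := hZ₂ X (g ≫ c) (by rwa [Category.assoc])
    -- injectivity of `f` on extensions by `S` lifts `S ⟶ M ⟶ Q` to `W`
    obtain ⟨t, ht⟩ := ExtData.exists_lift h (p ≫ m) (eq_zero_of_push_eq_zero hA hB hf hS (by
      rw [D.push_pull, ← D.pull_pull, ExtData.pull_eq_zero hM, map_zero]))
    obtain ⟨q, hq⟩ := ExtData.exists_factor hM (p - t ≫ w) (by simp [← hwm, ht])
    obtain ⟨k, hk⟩ := ExtData.exists_factor h (s ≫ t) (by
      rw [Category.assoc, ht, reassoc_of% hsp, ExtData.comp_eq_zero hM, comp_zero])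
    obtain ⟨k', hk'⟩ := ExtData.exists_factor_of_push h f hM (g - s ≫ q - k ≫ f) (by
      simp [hq, ← hw, reassoc_of% hk, hsp])
    refine ⟨k + k', ?_⟩
    have : g - (k + k') ≫ f = s ≫ q := by rw [Preadditive.add_comp, hk']; abel
    rw [this]
    exact (hB S hS q).comp_left s

/-- The dual of `exists_cokernel`. -/
lemma exists_kernel {A B : C} (hA : P.Plus A) (hA' : P.Minus A) (hB : P.Plus B)
    (hB' : P.Minus B) (f : A ⟶ B) :
    ∃ (Z : C) (g : Z ⟶ A), P.Plus Z ∧ P.Minus Z ∧ P.Null (g ≫ f) ∧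
      (∀ (Y : C) (_ : P.Minus Y) (h : Y ⟶ A), P.Null (h ≫ f) → ∃ k : Y ⟶ Z, k ≫ g = h) ∧
      (∀ (Y : C) (_ : P.Minus Y) (k : Y ⟶ Z), P.Null (k ≫ g) → P.Null k) ∧
      ((∀ X, P.Plus X → P.Minus X → ∀ g : B ⟶ X, P.Null (f ≫ g) → P.Null g) →
        ∀ (X : C) (h : A ⟶ X), P.Null (g ≫ h) → ∃ k : B ⟶ X, P.Null (h - f ≫ k)) := by
  obtain ⟨Z, g, h₁, h₂, h₃, h₄, h₅, h₆⟩ := exists_cokernel (P := P.op) (A := .op B) (B := .op A)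
    (plus_op.2 hB') (minus_op.2 hB) (plus_op.2 hA') (minus_op.2 hA) f.op
  refine ⟨Z.unop, g.unop, minus_op.1 h₂, plus_op.1 h₁, null_op.1 h₃, fun Y hY h hh => ?_,
    fun Y hY k hk => ?_, fun hf X h hh => ?_⟩
  · obtain ⟨k, hk⟩ := h₄ (.op Y) (plus_op.2 hY) h.op (null_op.2 hh)
    exact ⟨k.unop, Quiver.Hom.op_inj hk⟩
  · exact null_op.1 (h₅ (.op Y) (plus_op.2 hY) k.op (null_op.2 hk))
  · obtain ⟨k, hk⟩ := h₆ (fun X hX hX' g hg => null_op.2 (hf X.unop (minus_op.1 hX')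
      (plus_op.1 hX) g.unop (null_op.1 hg))) (.op X) h.op (null_op.2 hh)
    exact ⟨k.unop, null_op.1 hk⟩

end

end CotData

end Abstract

/-! ### The structures underlying an extriangulated category and a cotorsion pair -/

section Heart

variable {𝓑 : Type u} [Category.{v} 𝓑]

lemma seqClass_eq_iff {A B B' D : 𝓑} {x : A ⟶ B} {y : B ⟶ D} {x' : A ⟶ B'} {y' : B' ⟶ D} :
    seqClass x y = seqClass x' y' ↔ ∃ b : B ≅ B', x ≫ b.hom = x' ∧ b.hom ≫ y' = y :=
  Quotient.eq (r := seqSetoid A D)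

variable [Preadditive 𝓑] [HasBinaryBiproducts 𝓑]

lemma isSplit_iff {A B D : 𝓑} {x : A ⟶ B} {y : B ⟶ D} :
    IsSplit x y ↔ ∃ b : A ⊞ D ≅ B, biprod.inl ≫ b.hom = x ∧ b.hom ≫ y = biprod.snd := by
  constructor
  · rintro ⟨r, s, h₁, h₂, h₃, h₄, h₅⟩
    refine ⟨⟨biprod.desc x s, biprod.lift r y, ?_, ?_⟩, ?_, ?_⟩
    · ext <;> simp [h₁, h₂, h₃, h₄]
    · simp [h₅]
    · simp
    · ext <;> simp [h₂, h₄]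
  · rintro ⟨b, rfl, h⟩
    refine ⟨b.inv ≫ biprod.fst, biprod.inr ≫ b.hom, by simp, by simp [h], by simp, by simp [h], ?_⟩
    rw [← cancel_epi b.hom, ← cancel_mono b.inv]
    simp [reassoc_of% h, biprod.total]

variable [HasZeroObject 𝓑]

/-- The underlying `ExtData` of an extriangulated category. -/
def Extriangulation.toExtData (T : Extriangulation.{w} 𝓑) : ExtData.{w} 𝓑 where
  E X Y := Extn T.𝔼 X Y
  grp X Y := inferInstance
  push {X _ _} a := ((T.𝔼.obj (op X)).map a).hom
  pull {_ _ A} c := ((T.𝔼.map c.op).app A).hom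
  real δ x y := T.𝔰 δ = seqClass x y
  push_id δ := by simp
  pull_id δ := by simp
  push_push a b δ := by simp
  pull_pull a b δ := by simp
  push_pull {_ _ _ _} a c δ :=
    (ConcreteCategory.congr_hom ((T.𝔼.map c.op).naturality a) δ).symm
  push_add := T.push_add
  pull_add := T.pull_add
  exists_real δ := by
    obtain ⟨⟨Y, x, y⟩, h⟩ := _root_.Quotient.exists_rep (T.𝔰 δ)
    exact ⟨Y, x, y, h.symm⟩
  real_zero x y := by rw [T.realize_zero, seqClass_eq_iff, isSplit_iff]
  real_map := T.realize_map
  ET3 := T.ET3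
  ET3op := T.ET3op
  ET4 h h' := by
    obtain ⟨Z, _, h', d, e, δ, rfl, h₁, h₂, h₃, h₄, h₅, h₆⟩ := T.ET4 h h'
    exact ⟨Z, h', d, e, δ, h₁, h₂, h₃, h₄, h₅, h₆⟩
  ET4op h h' := by
    obtain ⟨Z, h', _, d, e, δ, rfl, h₁, h₂, h₃, h₄, h₅, h₆⟩ := T.ET4op h h'
    exact ⟨Z, h', d, e, δ, h₁, h₂, h₃, h₄, h₅, h₆⟩

namespace CotorsionPair

variable {T : Extriangulation.{w} 𝓑} (P : CotorsionPair T)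

/-- The underlying `CotData` of a cotorsion pair: each class is the full orthogonal of the other
because a split conflation exhibits its ends as direct summands of its middle term. -/
def toCotData : CotData T.toExtData where
  U := P.U
  V := P.V
  U_iff X := by
    refine ⟨fun h Y hY δ => P.ext_eq_zero X Y h hY δ, fun h => ?_⟩
    obtain ⟨Y, Z, i, p, hY, hZ, δ, hδ⟩ := P.left_complete X
    obtain rfl : δ = 0 := h Y hY δ
    obtain ⟨b, -⟩ := isSplit_iff.1 ((T.toExtData.real_zero _ _).1 hδ)
    exact P.additive_U.summand X Y (P.additive_U.iso _ _ (b.symm ≪≫ biprod.braiding Y X) hZ)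
  V_iff Y := by
    refine ⟨fun h X hX δ => P.ext_eq_zero X Y hX h δ, fun h => ?_⟩
    obtain ⟨Z, X, i, p, hZ, hX, δ, hδ⟩ := P.right_complete Y
    obtain rfl : δ = 0 := h X hX δ
    obtain ⟨b, -⟩ := isSplit_iff.1 ((T.toExtData.real_zero _ _).1 hδ)
    exact P.additive_V.summand Y X (P.additive_V.iso _ _ b.symm hZ)
  left B := by
    obtain ⟨Y, X, i, p, hY, hX, δ, hδ⟩ := P.left_complete B
    exact ⟨Y, X, δ, i, p, hY, hX, hδ⟩
  right B := by
    obtain ⟨Y, X, i, p, hY, hX, δ, hδ⟩ := P.right_complete B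
    exact ⟨Y, X, δ, i, p, hY, hX, hδ⟩

variable {P}

lemma rel_iff {X Y : 𝓑} {f g : X ⟶ Y} : P.rel f g ↔ P.toCotData.Null (f - g) :=
  ⟨fun ⟨Z, a, b, h, h'⟩ => ⟨Z, a, b, h.1, h.2, h'.symm⟩,
    fun ⟨Z, a, b, h₁, h₂, h'⟩ => ⟨Z, a, b, ⟨h₁, h₂⟩, h'.symm⟩⟩

lemma H_iff {X : 𝓑} : P.H X ↔ P.toCotData.Plus X ∧ P.toCotData.Minus X := by
  refine and_congr ⟨?_, fun h => ?_⟩ ⟨?_, fun h => ?_⟩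
  · rintro ⟨Y, Z, i, p, hY, hZ, δ, hδ⟩
    exact CotData.plus_of_real (P := P.toCotData) hδ hY hZ.2
  · obtain ⟨Y, Z, δ, i, p, h₁, h₂, h₃, h₄⟩ := h.exists_real
    exact ⟨Y, Z, i, p, h₁, ⟨h₂, h₃⟩, δ, h₄⟩
  · rintro ⟨Z, Y, i, p, hZ, hY, δ, hδ⟩
    exact CotData.minus_of_real (P := P.toCotData) hδ hY hZ.1
  · obtain ⟨Z, Y, δ, i, p, h₁, h₂, h₃, h₄⟩ := h.exists_real
    exact ⟨Z, Y, i, p, ⟨h₂, h₃⟩, h₁, δ, h₄⟩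

lemma H_biprod {X Y : 𝓑} (hX : P.H X) (hY : P.H Y) : P.H (X ⊞ Y) := by
  rw [H_iff] at *
  constructor
  · intro T hT f
    have : f = (f ≫ biprod.fst) ≫ biprod.inl + (f ≫ biprod.snd) ≫ biprod.inr := by
      ext <;> simp
    rw [this]
    exact ((hX.1 T hT _).comp_right _).add ((hY.1 T hT _).comp_right _)
  · intro T hT f
    have : f = biprod.fst ≫ biprod.inl ≫ f + biprod.snd ≫ biprod.inr ≫ f := by
      ext <;> simp
    rw [this]
    exact ((hX.2 T hT _).comp_left _).add ((hY.2 T hT _).comp_left _)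

/-! ### The heart -/

namespace Heart

/-- The object of the heart given by an object of `𝓗`. -/
def mk (X : 𝓑) (hX : P.H X) : P.Heart := ⟨⟨X⟩, hX⟩

/-- The morphism of the heart represented by a morphism of `𝓑`. -/
def homMk {X Y : P.Heart} (f : X.obj.as ⟶ Y.obj.as) : X ⟶ Y :=
  ObjectProperty.homMk ((CategoryTheory.Quotient.functor P.rel).map f)

lemma homMk_surjective {X Y : P.Heart} : Function.Surjective (homMk (X := X) (Y := Y)) := by
  rintro ⟨⟨f⟩⟩
  exact ⟨f, rfl⟩

lemma homMk_id (X : P.Heart) : homMk (X := X) (Y := X) (𝟙 X.obj.as) = 𝟙 X := rfl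

lemma homMk_eq_iff {X Y : P.Heart} {f g : X.obj.as ⟶ Y.obj.as} :
    homMk (X := X) (Y := Y) f = homMk g ↔ P.toCotData.Null (f - g) := by
  rw [← rel_iff, ← CategoryTheory.Quotient.functor_map_eq_iff P.rel]
  exact ⟨fun h => congr_arg (fun k : X ⟶ Y => k.hom) h, fun h => ObjectProperty.hom_ext _ h⟩

lemma homMk_zero (X Y : P.Heart) : homMk (X := X) (Y := Y) 0 = 0 := rfl

lemma homMk_eq_zero_iff {X Y : P.Heart} {f : X.obj.as ⟶ Y.obj.as} :
    homMk (X := X) (Y := Y) f = 0 ↔ P.toCotData.Null f := by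
  rw [← homMk_zero, homMk_eq_iff, sub_zero]

lemma plus (X : P.Heart) : P.toCotData.Plus X.obj.as := (H_iff.1 X.property).1

lemma minus (X : P.Heart) : P.toCotData.Minus X.obj.as := (H_iff.1 X.property).2

lemma null_of_mono {X Y : P.Heart} {f : X.obj.as ⟶ Y.obj.as} [Mono (homMk (X := X) (Y := Y) f)]
    (Z : 𝓑) (hZ : P.toCotData.Plus Z) (hZ' : P.toCotData.Minus Z) (g : Z ⟶ X.obj.as)
    (hg : P.toCotData.Null (g ≫ f)) : P.toCotData.Null g := by
  let Z' : P.Heart := mk Z (H_iff.2 ⟨hZ, hZ'⟩)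
  exact homMk_eq_zero_iff.1 <| (cancel_mono (homMk (X := X) (Y := Y) f)).1 <|
    (homMk_eq_zero_iff (X := Z').2 hg).trans zero_comp.symm

lemma null_of_epi {X Y : P.Heart} {f : X.obj.as ⟶ Y.obj.as} [Epi (homMk (X := X) (Y := Y) f)]
    (Z : 𝓑) (hZ : P.toCotData.Plus Z) (hZ' : P.toCotData.Minus Z) (g : Y.obj.as ⟶ Z)
    (hg : P.toCotData.Null (f ≫ g)) : P.toCotData.Null g := by
  let Z' : P.Heart := mk Z (H_iff.2 ⟨hZ, hZ'⟩)
  exact homMk_eq_zero_iff.1 <| (cancel_epi (homMk (X := X) (Y := Y) f)).1 <|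
    (homMk_eq_zero_iff (Y := Z').2 hg).trans comp_zero.symm

variable (P) in
lemma hasZeroObject : HasZeroObject P.Heart := by
  obtain ⟨Z, hZ⟩ := ‹HasZeroObject 𝓑›.zero
  have hH : P.H Z := H_iff.2
    ⟨fun X _ f => ⟨Z, f, 𝟙 Z, P.additive_U.zero Z hZ, P.additive_V.zero Z hZ, by simp⟩,
      fun X _ f => ⟨Z, 𝟙 Z, f, P.additive_U.zero Z hZ, P.additive_V.zero Z hZ, by simp⟩⟩
  refine ⟨mk Z hH, (IsZero.iff_id_eq_zero _).2 ?_⟩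
  rw [← homMk_id, ← homMk_zero]
  exact congr_arg homMk (hZ.eq_of_src _ _)

variable (P) in
lemma hasBinaryBiproducts : HasBinaryBiproducts P.Heart where
  has_binary_biproduct X Y :=
    hasBinaryBiproduct_of_total
      { pt := mk (X.obj.as ⊞ Y.obj.as) (H_biprod X.property Y.property)
        fst := homMk biprod.fst
        snd := homMk biprod.snd
        inl := homMk biprod.inl
        inr := homMk biprod.inr
        inl_fst := congr_arg homMk biprod.inl_fst
        inl_snd := congr_arg homMk biprod.inl_snd
        inr_fst := congr_arg homMk biprod.inr_fst
        inr_snd := congr_arg homMk biprod.inr_snd }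
      (congr_arg homMk biprod.total)

variable (P) in
lemma hasFiniteProducts : HasFiniteProducts P.Heart := by
  have := hasZeroObject P
  have := hasBinaryBiproducts P
  exact hasFiniteProducts_of_has_binary_and_terminal

/-- Cokernels in the heart; a monomorphism is a kernel of its cokernel. -/
lemma exists_isColimit {X Y : P.Heart} (f : X ⟶ Y) :
    ∃ (Z : P.Heart) (g : Y ⟶ Z) (w : f ≫ g = 0), Nonempty (IsColimit (CokernelCofork.ofπ g w)) ∧
      (Mono f → Nonempty (IsLimit (KernelFork.ofι f w))) := by
  obtain ⟨f, rfl⟩ := homMk_surjective f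
  obtain ⟨Z, g, hZ, hZ', hw, hd, hg, hf⟩ :=
    CotData.exists_cokernel X.plus X.minus Y.plus Y.minus f
  let Z' : P.Heart := mk Z (H_iff.2 ⟨hZ, hZ'⟩)
  let g' : Y ⟶ Z' := homMk g
  have hepi : Epi g' := Preadditive.epi_of_cancel_zero _ fun {T} k hk => by
    obtain ⟨k, rfl⟩ := homMk_surjective k
    exact homMk_eq_zero_iff.2 (hg _ T.plus k (homMk_eq_zero_iff.1 hk))
  have hw' : homMk f ≫ g' = 0 := homMk_eq_zero_iff.2 hw
  refine ⟨Z', g', hw', ⟨CokernelCofork.IsColimit.ofπ' g' hw' fun {T} h hh => ?_⟩, fun hm =>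
    ⟨KernelFork.IsLimit.ofι' (homMk f) hw' fun {T} h hh => ?_⟩⟩
  · refine Classical.choice ?_
    obtain ⟨h, rfl⟩ := homMk_surjective h
    obtain ⟨k, rfl⟩ := hd _ T.plus h (homMk_eq_zero_iff.1 hh)
    exact ⟨homMk (X := Z') k, rfl⟩
  · refine Classical.choice ?_
    obtain ⟨h, rfl⟩ := homMk_surjective h
    obtain ⟨k, hk⟩ := hf null_of_mono _ h (homMk_eq_zero_iff.1 hh)
    exact ⟨homMk k, (homMk_eq_iff.2 hk).symm⟩

/-- Kernels in the heart; an epimorphism is a cokernel of its kernel. -/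
lemma exists_isLimit {X Y : P.Heart} (f : X ⟶ Y) :
    ∃ (Z : P.Heart) (g : Z ⟶ X) (w : g ≫ f = 0), Nonempty (IsLimit (KernelFork.ofι g w)) ∧
      (Epi f → Nonempty (IsColimit (CokernelCofork.ofπ f w))) := by
  obtain ⟨f, rfl⟩ := homMk_surjective f
  obtain ⟨Z, g, hZ, hZ', hw, hd, hg, hf⟩ :=
    CotData.exists_kernel X.plus X.minus Y.plus Y.minus f
  let Z' : P.Heart := mk Z (H_iff.2 ⟨hZ, hZ'⟩)
  let g' : Z' ⟶ X := homMk g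
  have hmono : Mono g' := Preadditive.mono_of_cancel_zero _ fun {T} k hk => by
    obtain ⟨k, rfl⟩ := homMk_surjective k
    exact homMk_eq_zero_iff.2 (hg _ T.minus k (homMk_eq_zero_iff.1 hk))
  have hw' : g' ≫ homMk f = 0 := homMk_eq_zero_iff.2 hw
  refine ⟨Z', g', hw', ⟨KernelFork.IsLimit.ofι' g' hw' fun {T} h hh => ?_⟩, fun hm =>
    ⟨CokernelCofork.IsColimit.ofπ' (homMk f) hw' fun {T} h hh => ?_⟩⟩
  · refine Classical.choice ?_
    obtain ⟨h, rfl⟩ := homMk_surjective h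
    obtain ⟨k, rfl⟩ := hd _ T.minus h (homMk_eq_zero_iff.1 hh)
    exact ⟨homMk (Y := Z') k, rfl⟩
  · refine Classical.choice ?_
    obtain ⟨h, rfl⟩ := homMk_surjective h
    obtain ⟨k, hk⟩ := hf null_of_epi _ h (homMk_eq_zero_iff.1 hh)
    exact ⟨homMk k, (homMk_eq_iff.2 hk).symm⟩

end Heart

end CotorsionPair

end Heart

end Extri

theorem theoremC18 {𝓑 : Type u} [CategoryTheory.Category.{v} 𝓑] [CategoryTheory.Preadditive 𝓑]
    [CategoryTheory.Limits.HasZeroObject 𝓑] [CategoryTheory.Limits.HasBinaryBiproducts 𝓑]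
    (T : Extri.Extriangulation.{w} 𝓑) (P : Extri.CotorsionPair T) :
    ∃ A : CategoryTheory.Abelian P.Heart,
      A.toPreadditive = (inferInstance : CategoryTheory.Preadditive P.Heart) := by
  refine ⟨{
    normalMonoOfMono := fun f _ => ?_
    normalEpiOfEpi := fun f _ => ?_
    has_finite_products := Extri.CotorsionPair.Heart.hasFiniteProducts P
    has_kernels := ⟨fun {X Y} f => ?_⟩
    has_cokernels := ⟨fun {X Y} f => ?_⟩ }, rfl⟩
  · obtain ⟨Z, g, w, -, h⟩ := Extri.CotorsionPair.Heart.exists_isColimit f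
    obtain ⟨h⟩ := h inferInstance
    exact ⟨⟨Z, g, w, h⟩⟩
  · obtain ⟨Z, g, w, -, h⟩ := Extri.CotorsionPair.Heart.exists_isLimit f
    obtain ⟨h⟩ := h inferInstance
    exact ⟨⟨Z, g, w, h⟩⟩
  · obtain ⟨Z, g, w, ⟨h⟩, -⟩ := Extri.CotorsionPair.Heart.exists_isLimit f
    exact ⟨⟨_, h⟩⟩
  · obtain ⟨Z, g, w, ⟨h⟩, -⟩ := Extri.CotorsionPair.Heart.exists_isColimit f
    exact ⟨⟨_, h⟩⟩
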